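/- Let $\mathbb N=\{1,2,3,\dots\}$, let $\mathcal P_0(\mathbb N)$ be the set of its finite subsets, and let $\mathbb P_{\mathbb N}$ be the group of permutations of $\mathbb N$ that move only finitely many points. A quasi-local algebra is a unital $C^*$-algebra $\mathfrak A$ with a $*$-automorphism $\theta$ satisfying $\theta^2=\mathrm{id}$ and with closed $*$-subalgebras $\mathfrak A(I)\subset\mathfrak A$, $I\in\mathcal P_0(\mathbb N)$, each containing the unit of $\mathfrak A$, such that $\bigcup_I\mathfrak A(I)$ is dense in $\mathfrak A$ and (i) $\mathfrak A(I)\subset\mathfrak A(J)$ whenever $I\subset J$; (ii) $\theta(\mathfrak A(I))=\mathfrak A(I)$ for every $I$; (iii) if $I\cap J=\emptyset$ and $x\in\mathfrak A(I)$, $y\in\mathfrak A(J)$ are homogeneous (each is even, $\theta(z)=z$, or odd, $\theta(z)=-z$), then $xy=yx$ if $x$ or $y$ is even, and $xy=-yx$ if both are odd. A local action of $\mathbb P_{\mathbb N}$ on $\mathfrak A$ is a group homomorphism $\alpha:\mathbb P_{\mathbb N}\to\mathrm{Aut}(\mathfrak A)$, $\sigma\mapsto\alpha_\sigma$, such that $\alpha_\sigma\circ\theta=\theta\circ\alpha_\sigma$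 and $\alpha_\sigma(\mathfrak A(I))=\mathfrak A(\sigma(I))$ for all $\sigma\in\mathbb P_{\mathbb N}$ and $I\in\mathcal P_0(\mathbb N)$, and such that $\alpha_\sigma(a)=a$ for every $a\in\mathfrak A(I)$ whenever $\sigma(i)=i$ for all $i\in I$. A state $\omega$ on $\mathfrak A$ is symmetric if $\omega\circ\alpha_\sigma=\omega$ for every $\sigma\in\mathbb P_{\mathbb N}$. For $n\ge 1$ let $\sigma_n\in\mathbb P_{\mathbb N}$ be given by $\sigma_n(k)=k+2^{n-1}$ for $1\le k\le 2^{n-1}$, $\sigma_n(k)=k-2^{n-1}$ for $2^{n-1}<k\le 2^n$, and $\sigma_n(k)=k$ for $k>2^n$. **Theorem.** Let $\alpha$ be a local action of $\mathbb P_{\mathbb N}$ on a quasi-local algebra $\mathfrak A$, and let $\omega$ be a symmetric state on $\mathfrak A$. The following conditions are equivalent: 1. $\omega$ is an extreme point of the convex set of symmetric states; 2. $\omega$ is strongly clustering, that is, $\lim_{n\to\infty}\omega(\alpha_{\sigma_n}(a)b)=\omega(a)\omega(b)$ for all $a,b\in\mathfrak A$; 3. $\omega(ab)=\omega(a)\omega(b)$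 for all finite $I,J\subset\mathbb N$ with $I\cap J=\emptyset$, all $a\in\mathfrak A(I)$ and all $b\in\mathfrak A(J)$. -/

import Mathlib

namespace QuasiLocal

/-- The group of finite permutations of `{1, 2, 3, …}`: the permutations that move only
finitely many points. -/
def FinPerm : Subgroup (Equiv.Perm ℕ+) where
  carrier := {σ | {k | σ k ≠ k}.Finite}
  one_mem' := by simp
  mul_mem' := by
    intro σ τ hσ hτ
    refine (Set.Finite.union hσ hτ).subset ?_
    intro k hk
    by_contra h
    simp only [Set.mem_union, Set.mem_ofPred_eq, not_or, not_not] at h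
    exact hk (by simp [h.1, h.2])
  inv_mem' := by
    intro σ hσ
    refine Set.Finite.subset hσ ?_
    intro k hk h
    exact hk (by rw [Equiv.Perm.inv_eq_iff_eq]; exact h.symm)

/-- The map exchanging the block `{1, …, m}` with the block `{m + 1, …, 2 m}` by a translation of
length `m`, and fixing every `k > 2 m`. -/
def blockSwapFun (m k : ℕ+) : ℕ+ :=
  if k ≤ m then k + m else if k ≤ 2 * m then k - m else k

theorem blockSwapFun_blockSwapFun (m k : ℕ+) : blockSwapFun m (blockSwapFun m k) = k := by
  have hm := m.pos
  have hk := k.pos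
  apply PNat.eq
  unfold blockSwapFun
  simp only [← PNat.coe_le_coe, apply_ite PNat.val, PNat.add_coe, PNat.sub_coe, PNat.mul_coe,
    ← PNat.coe_lt_coe, PNat.val_ofNat]
  split_ifs <;> omega

/-- `blockSwapFun m` as a permutation. -/
def blockSwap (m : ℕ+) : Equiv.Perm ℕ+ where
  toFun := blockSwapFun m
  invFun := blockSwapFun m
  left_inv := blockSwapFun_blockSwapFun m
  right_inv := blockSwapFun_blockSwapFun m

theorem blockSwap_mem (m : ℕ+) : blockSwap m ∈ FinPerm := by
  refine (Set.finite_Iic (2 * m)).subset ?_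
  intro k hk
  by_contra h
  apply hk
  have h1 : ¬ k ≤ 2 * m := h
  have h2 : ¬ k ≤ m := by
    intro h3
    apply h1
    rw [← PNat.coe_le_coe] at h3 ⊢
    rw [PNat.mul_coe, PNat.val_ofNat]
    omega
  change blockSwapFun m k = k
  simp [blockSwapFun, h1, h2]

/-- For `n ≥ 1`, the permutation `σ_n` exchanging `{1, …, 2 ^ (n - 1)}` with
`{2 ^ (n - 1) + 1, …, 2 ^ n}` (the index `n = 0` is only a harmless repetition of `n = 1`). -/
def sigma (n : ℕ) : FinPerm := ⟨blockSwap (2 ^ (n - 1)), blockSwap_mem _⟩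

variable (A : Type*) [CStarAlgebra A]

/-- A quasi-local structure over the finite subsets of `{1, 2, 3, …}` on the unital
`C*`-algebra `A`: a `ℤ/2`-grading, given by an involutive `*`-automorphism, and a net of unital
`C*`-subalgebras with dense union. -/
structure QuasiLocalAlgebra where
  /-- the grading automorphism `θ` -/
  grading : A ≃⋆ₐ[ℂ] A
  grading_grading : ∀ a, grading (grading a) = a
  /-- the local algebras -/
  loc : Finset ℕ+ → StarSubalgebra ℂ A
  isClosed_loc : ∀ I, IsClosed (loc I : Set A)
  dense_iUnion_loc : Dense (⋃ I, (loc I : Set A))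
  loc_mono : ∀ I J, I ⊆ J → loc I ≤ loc J
  grading_image_loc : ∀ I, grading '' (loc I : Set A) = loc I
  /-- homogeneous elements with disjoint localization commute if one of them is even -/
  commute_of_even : ∀ I J, Disjoint I J → ∀ x ∈ loc I, ∀ y ∈ loc J,
    (grading x = x ∨ grading x = -x) → (grading y = y ∨ grading y = -y) →
      (grading x = x ∨ grading y = y) → x * y = y * x
  /-- odd elements with disjoint localization anticommute -/
  anticommute_of_odd : ∀ I J, Disjoint I J → ∀ x ∈ loc I, ∀ y ∈ loc J,
    grading x = -x → grading y = -y → x * y = -(y * x)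

variable {A}

/-- A local action of the finite permutations on a quasi-local algebra. A permutation carries the
algebra of a region `I` onto the algebra of `σ(I)`, and acts trivially on the algebra of a region
each of whose points it fixes. -/
structure LocalAction (Q : QuasiLocalAlgebra A) where
  /-- the action by `*`-automorphisms (the product of automorphisms is their composition) -/
  toHom : FinPerm →* (A ≃⋆ₐ[ℂ] A)
  map_grading : ∀ σ a, toHom σ (Q.grading a) = Q.grading (toHom σ a)
  image_loc : ∀ (I : Finset ℕ+) (σ : FinPerm),
    toHom σ '' (Q.loc I : Set A) = Q.loc (I.map (σ : Equiv.Perm ℕ+).toEmbedding)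
  apply_eq_self : ∀ (I : Finset ℕ+) (σ : FinPerm),
    (∀ i ∈ I, (σ : Equiv.Perm ℕ+) i = i) → ∀ a ∈ Q.loc I, toHom σ a = a

section

open scoped ComplexOrder

variable (A) in
/-- The states of `A`: the positive functionals of value `1` at the unit. -/
def states : Set (A →L[ℂ] ℂ) :=
  {ω | (∀ a, 0 ≤ ω (star a * a)) ∧ ω 1 = 1}

end

/-- The symmetric (that is, invariant) states of a local action. -/
def symmetricStates {Q : QuasiLocalAlgebra A} (α : LocalAction Q) : Set (A →L[ℂ] ℂ) :=
  {ω | ω ∈ states A ∧ ∀ σ a, ω (α.toHom σ a) = ω a}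

/-- Strong clustering: `ω(α_{σ_n}(a) b) → ω(a) ω(b)` for all `a` and `b`. -/
def StronglyClustering {Q : QuasiLocalAlgebra A} (α : LocalAction Q) (ω : A →L[ℂ] ℂ) : Prop :=
  ∀ a b : A, Filter.Tendsto (fun n : ℕ => ω (α.toHom (sigma n) a * b)) Filter.atTop
    (nhds (ω a * ω b))

end QuasiLocal

/-!
A symmetric state cannot distinguish the infinitely many pairwise disjoint copies of a local
element, and the argument rests on a law of large numbers: if the second moments of the partial
sums of `x₀, x₁, …` grow at most linearly, then by Cauchy–Schwarz a correlation `ω (a xₖ)` which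
does not depend on `k` must vanish. The disjoint copies of an odd element anticommute, so odd
elements are uncorrelated with everything localized elsewhere. In a product state `ω` the disjoint
copies of `x - ω(x)` are uncorrelated, so every symmetric state dominated by a multiple of `ω`
agrees with `ω`, and `ω` is extreme.

Conversely, let `ω` be extreme and let `b` be local, even and self-adjoint with `ω(b) = 0`. Moving
`b` to infinity gives an invariant functional `φ(a) = lim ω(a α_{σ_n}(b))`. Since a distant copy of
`b` commutes with `a`, the functionals `‖b‖ ω ± φ` are positive, and extremality forces `φ = 0`;
but `φ(a) = ω(a b)` as soon as `a` and `b` have disjoint localization. Finally, for local `a` and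
`b` the sequence `ω(α_{σ_n}(a) b)` is eventually constant, which relates clustering to the product
property.
-/

namespace QuasiLocal

open Filter Topology
open scoped Pointwise ComplexOrder

section Permutations

theorem exists_perm_finite_eqOn {ι : Type*} (K : Finset ι) {f : ι → ι} (hf : Set.InjOn f K) :
    ∃ τ : Equiv.Perm ι, {k | τ k ≠ k}.Finite ∧ Set.EqOn τ f K := by
  classical
  set T : Finset ι := K ∪ K.image f
  obtain ⟨g, hg⟩ := Set.MapsTo.exists_equiv_extend_of_card_eq (α := T) (t := T)
    (Fintype.card_coe T) (s := {x | (x : ι) ∈ K}) (f := fun x => f x)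
    (fun x hx => Finset.mem_union_right _ (Finset.mem_image_of_mem f hx))
    (fun x hx y hy h => Subtype.ext (hf hx hy h))
  refine ⟨Equiv.Perm.ofSubtype g, T.finite_toSet.subset fun k hk => ?_, fun k hk => ?_⟩
  · by_contra hkT
    exact hk (Equiv.Perm.ofSubtype_apply_of_not_mem g hkT)
  · have hkT : k ∈ T := Finset.mem_union_left _ hk
    exact (Equiv.Perm.ofSubtype_apply_of_mem g hkT).trans (hg ⟨k, hkT⟩ hk)

variable {I J : Finset ℕ+}

theorem exists_finPerm_smul_eq (hIJ : Disjoint I J) {f g : ℕ+ → ℕ+} (hf : Set.InjOn f I)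
    (hg : Set.InjOn g J) (hfg : ∀ i ∈ I, ∀ j ∈ J, f i ≠ g j) :
    ∃ ρ : FinPerm, (∀ i ∈ I, ρ • i = f i) ∧ ∀ j ∈ J, ρ • j = g j := by
  have hfI : Set.EqOn ((I : Set ℕ+).piecewise f g) f I := Set.piecewise_eqOn _ _ _
  have hgJ : Set.EqOn ((I : Set ℕ+).piecewise f g) g J := fun j hj =>
    Set.piecewise_eq_of_notMem _ _ _ (Finset.disjoint_right.1 hIJ hj)
  have hinj : Set.InjOn ((I : Set ℕ+).piecewise f g) (I ∪ J : Finset ℕ+) := by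
    rw [Finset.coe_union, Set.injOn_union (Finset.disjoint_coe.2 hIJ)]
    refine ⟨hf.congr hfI.symm, hg.congr hgJ.symm, fun i hi j hj => ?_⟩
    rw [hfI hi, hgJ hj]
    exact hfg i hi j hj
  obtain ⟨ρ, hρ, hρK⟩ := exists_perm_finite_eqOn (I ∪ J) hinj
  exact ⟨⟨ρ, hρ⟩, fun i hi => (hρK (Finset.mem_union_left _ hi)).trans (hfI hi),
    fun j hj => (hρK (Finset.mem_union_right _ hj)).trans (hgJ hj)⟩

theorem exists_seq_finPerm_disjoint_smul (hIJ : Disjoint I J) :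
    ∃ τ : ℕ → FinPerm, (∀ k, ∀ i ∈ I, τ k • i = i) ∧
      Pairwise fun k l => Disjoint (τ k • J) (τ l • J) := by
  have : Infinite {k // k ∉ I} := I.finite_toSet.infinite_compl.to_subtype
  obtain ⟨c⟩ := nonempty_embedding_nat (ℕ × ℕ+)
  let e : ℕ × ℕ+ ↪ {k // k ∉ I} := c.trans (Infinite.natEmbedding _)
  have hτ : ∀ k, ∃ τ : FinPerm, (∀ i ∈ I, τ • i = i) ∧ ∀ j ∈ J, τ • j = e (k, j) := fun k =>
    exists_finPerm_smul_eq hIJ (Set.injOn_id _)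
      (fun x _ y _ h => (Prod.mk.inj (e.injective (Subtype.ext h))).2)
      fun i hi j _ h => (e (k, j)).2 (h ▸ hi)
  choose τ hτI hτJ using hτ
  refine ⟨τ, hτI, fun k l hkl => ?_⟩
  simp only [Finset.disjoint_left, Finset.mem_smul_finset]
  rintro _ ⟨x, hx, rfl⟩ ⟨y, hy, hxy⟩
  rw [hτJ l y hy, hτJ k x hx] at hxy
  exact hkl (Prod.mk.inj (e.injective (Subtype.ext hxy))).1.symm

theorem sigma_smul_of_le {n : ℕ} {k : ℕ+} (hk : k ≤ 2 ^ (n - 1)) :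
    sigma n • k = k + 2 ^ (n - 1) :=
  if_pos hk

theorem eventually_disjoint_sigma_smul (K L : Finset ℕ+) :
    ∀ᶠ n in atTop, Disjoint (sigma n • K) L := by
  have hlarge : ∀ k : ℕ+, ∀ᶠ n in atTop, k ≤ 2 ^ (n - 1) := fun k => by
    filter_upwards [eventually_gt_atTop (k : ℕ)] with n hn
    rw [← PNat.coe_le_coe, PNat.pow_coe]
    exact Nat.lt_two_pow_self.le.trans (Nat.pow_le_pow_right two_pos (Nat.le_sub_one_of_lt hn))
  filter_upwards [(Finset.eventually_all K).2 fun k _ => hlarge k,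
    (Finset.eventually_all L).2 fun k _ => hlarge k] with n hK hL
  simp only [Finset.disjoint_left, Finset.mem_smul_finset]
  rintro _ ⟨k, hk, rfl⟩ hkL
  have hle := hL _ hkL
  rw [sigma_smul_of_le (hK k hk)] at hle
  exact (PNat.lt_add_left _ k).not_ge hle

end Permutations

section LocalAction

variable {A : Type*} [CStarAlgebra A] {Q : QuasiLocalAlgebra A} {I J : Finset ℕ+} {a b : A}

theorem QuasiLocalAlgebra.grading_mem (Q : QuasiLocalAlgebra A) (ha : a ∈ Q.loc I) :
    Q.grading a ∈ Q.loc I := by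
  rw [← SetLike.mem_coe, ← Q.grading_image_loc]
  exact Set.mem_image_of_mem _ ha

theorem QuasiLocalAlgebra.exists_even_add_odd (Q : QuasiLocalAlgebra A) (ha : a ∈ Q.loc I) :
    ∃ x ∈ Q.loc I, ∃ y ∈ Q.loc I, Q.grading x = x ∧ Q.grading y = -y ∧ x + y = a := by
  refine ⟨(2⁻¹ : ℂ) • (a + Q.grading a), (Q.loc I).smul_mem (add_mem ha (Q.grading_mem ha)) _,
    (2⁻¹ : ℂ) • (a - Q.grading a), (Q.loc I).smul_mem (sub_mem ha (Q.grading_mem ha)) _,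
    ?_, ?_, ?_⟩
  · rw [map_smul, map_add, Q.grading_grading, add_comm]
  · rw [map_smul, map_sub, Q.grading_grading, ← smul_neg, neg_sub]
  · module

theorem QuasiLocalAlgebra.commute_of_grading_eq (Q : QuasiLocalAlgebra A) (hIJ : Disjoint I J)
    (ha : a ∈ Q.loc I) (hb : b ∈ Q.loc J) (heven : Q.grading b = b) : Commute a b := by
  obtain ⟨x, hx, y, hy, hxeven, hyodd, rfl⟩ := Q.exists_even_add_odd ha
  exact Commute.add_left
    (Q.commute_of_even I J hIJ x hx b hb (Or.inl hxeven) (Or.inl heven) (Or.inr heven))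
    (Q.commute_of_even I J hIJ y hy b hb (Or.inr hyodd) (Or.inl heven) (Or.inr heven))

theorem QuasiLocalAlgebra.induction_local (Q : QuasiLocalAlgebra A) {p : A → Prop}
    (hclosed : IsClosed {a | p a}) (hlocal : ∀ I, ∀ a ∈ Q.loc I, p a) (a : A) : p a :=
  Q.dense_iUnion_loc.induction
    (fun x hx => let ⟨I, hI⟩ := Set.mem_iUnion.1 hx; hlocal I x hI) hclosed a

theorem QuasiLocalAlgebra.continuousLinearMap_ext (Q : QuasiLocalAlgebra A) {φ ψ : A →L[ℂ] ℂ}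
    (h : ∀ I, ∀ a ∈ Q.loc I, φ a = ψ a) : φ = ψ :=
  ContinuousLinearMap.ext (Q.induction_local (isClosed_eq φ.continuous ψ.continuous) h)

namespace LocalAction

variable (α : LocalAction Q) {σ τ : FinPerm}

theorem apply_mem (σ : FinPerm) (ha : a ∈ Q.loc I) : α.toHom σ a ∈ Q.loc (σ • I) := by
  have himage : α.toHom σ '' (Q.loc I : Set A) = Q.loc (σ • I) := by
    rw [α.image_loc, Finset.map_eq_image]
    rfl
  rw [← SetLike.mem_coe, ← himage]
  exact Set.mem_image_of_mem _ ha

theorem mul_apply (σ τ : FinPerm) (a : A) :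
    α.toHom (σ * τ) a = α.toHom σ (α.toHom τ a) := by
  rw [map_mul, StarAlgEquiv.mul_apply]

theorem one_apply (a : A) : α.toHom 1 a = a := by
  rw [map_one, StarAlgEquiv.one_apply]

theorem apply_congr (h : ∀ i ∈ I, σ • i = τ • i) (ha : a ∈ Q.loc I) :
    α.toHom σ a = α.toHom τ a := by
  have hfix : ∀ i ∈ I, (τ⁻¹ * σ) • i = i := fun i hi => by
    rw [mul_smul, h i hi, inv_smul_smul]
  rw [← mul_inv_cancel_left τ σ, α.mul_apply, α.apply_eq_self I _ hfix a ha]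

end LocalAction

theorem map_apply_mul_apply_of_disjoint {α : LocalAction Q} {φ : A →L[ℂ] ℂ}
    (hφ : ∀ ρ a, φ (α.toHom ρ a) = φ a) (ha : a ∈ Q.loc I) (hb : b ∈ Q.loc J)
    (hIJ : Disjoint I J) {σ τ : FinPerm} (hστ : Disjoint (σ • I) (τ • J)) :
    φ (α.toHom σ a * α.toHom τ b) = φ (a * b) := by
  obtain ⟨ρ, hρI, hρJ⟩ := exists_finPerm_smul_eq hIJ (MulAction.injective σ).injOn
    (MulAction.injective τ).injOn fun i hi j hj => Finset.disjoint_iff_ne.1 hστ _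
      (Finset.smul_mem_smul_finset hi) _ (Finset.smul_mem_smul_finset hj)
  rw [← α.apply_congr hρI ha, ← α.apply_congr hρJ hb, ← map_mul (α.toHom ρ), hφ]

end LocalAction

section PositiveFunctional

attribute [local instance] CStarAlgebra.spectralOrder CStarAlgebra.spectralOrderedRing

variable {A : Type*} [CStarAlgebra A] {ω : A →L[ℂ] ℂ}

theorem apply_nonneg_of_nonneg (hω : ∀ a, 0 ≤ ω (star a * a)) {x : A} (hx : 0 ≤ x) :
    0 ≤ ω x := by
  obtain ⟨a, rfl⟩ := CStarAlgebra.nonneg_iff_eq_star_mul_self.1 hx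
  exact hω a

theorem map_star_of_nonneg (hω : ∀ a, 0 ≤ ω (star a * a)) (x : A) : ω (star x) = star (ω x) :=
  map_star (PositiveLinearMap.mk₀ ω.toLinearMap fun _ => apply_nonneg_of_nonneg hω) x

theorem apply_star_mul_add_mul_nonneg (hω : ∀ a, 0 ≤ ω (star a * a)) {b : A}
    (hb : IsSelfAdjoint b) (a : A) : 0 ≤ ω (star a * (algebraMap ℝ A ‖b‖ + b) * a) := by
  have hnonneg : 0 ≤ algebraMap ℝ A ‖b‖ + b :=
    neg_le_iff_add_nonneg'.1 hb.neg_algebraMap_norm_le_self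
  exact apply_nonneg_of_nonneg hω (star_left_conjugate_nonneg hnonneg a)

/-- The second moment `ω (x* x)` of `x`, that is, the square of the norm of `x` in the GNS space of
a positive functional `ω`. For such `ω` the value is real, so taking the real part loses nothing. -/
noncomputable def secondMoment (ω : A →L[ℂ] ℂ) (x : A) : ℝ :=
  (ω (star x * x)).re

theorem secondMoment_nonneg (hω : ∀ a, 0 ≤ ω (star a * a)) (x : A) : 0 ≤ secondMoment ω x :=
  (Complex.nonneg_iff.1 (hω x)).1

theorem norm_apply_mul_sq_le (hω : ∀ a, 0 ≤ ω (star a * a)) (x y : A) :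
    ‖ω (x * y)‖ ^ 2 ≤ secondMoment ω (star x) * secondMoment ω y := by
  let f : A →ₚ[ℂ] ℂ := PositiveLinearMap.mk₀ ω.toLinearMap fun _ => apply_nonneg_of_nonneg hω
  have h : ‖ω (star (star x) * y)‖ ^ 2 ≤ secondMoment ω (star x) * secondMoment ω y := by
    have hinner := inner_mul_inner_self_le (𝕜 := ℂ) (f.toPreGNS (star x)) (f.toPreGNS y)
    rwa [norm_inner_symm (f.toPreGNS y), ← sq] at hinner
  rwa [star_star] at h

theorem secondMoment_sum_of_uncorrelated {ι : Type*} (s : Finset ι) {x : ι → A}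
    (hx : Pairwise fun j k => ω (star (x j) * x k) = 0) :
    secondMoment ω (∑ k ∈ s, x k) = ∑ k ∈ s, secondMoment ω (x k) := by
  rw [secondMoment, star_sum, Finset.sum_mul_sum, map_sum, Complex.re_sum]
  refine Finset.sum_congr rfl fun j hj => ?_
  rw [map_sum, Finset.sum_eq_single_of_mem j hj fun k _ hkj => hx hkj.symm, secondMoment]

theorem secondMoment_sum_le_of_anticommute (hω : ∀ a, 0 ≤ ω (star a * a)) {ι : Type*}
    (s : Finset ι) {x : ι → A}
    (hx : Pairwise fun j k => star (x j) * x k = -(x k * star (x j))) :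
    secondMoment ω (∑ k ∈ s, x k) ≤
      ∑ k ∈ s, (secondMoment ω (x k) + secondMoment ω (star (x k))) := by
  -- In `S* S + S S*` the off-diagonal terms cancel.
  set S := ∑ k ∈ s, x k with hS
  have hdiag : star S * S + S * star S = ∑ k ∈ s, (star (x k) * x k + x k * star (x k)) := by
    rw [hS, star_sum, Finset.sum_mul_sum, Finset.sum_mul_sum,
      Finset.sum_comm (f := fun i j => x i * star (x j)), ← Finset.sum_add_distrib]
    refine Finset.sum_congr rfl fun j hj => ?_
    rw [← Finset.sum_add_distrib]
    exact Finset.sum_eq_single_of_mem j hj fun k _ hkj => by rw [hx hkj.symm, neg_add_cancel]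
  calc secondMoment ω S ≤ secondMoment ω S + secondMoment ω (star S) :=
        le_add_of_nonneg_right (secondMoment_nonneg hω _)
    _ = (ω (star S * S + S * star S)).re := by
        simp only [secondMoment, star_star, map_add, Complex.add_re]
    _ = ∑ k ∈ s, (secondMoment ω (x k) + secondMoment ω (star (x k))) := by
        simp only [hdiag, secondMoment, star_star, map_add, map_sum, Complex.add_re, Complex.re_sum]

theorem eq_zero_of_secondMoment_sum_le (hω : ∀ a, 0 ≤ ω (star a * a)) {a : A} {x : ℕ → A}
    {z : ℂ} {C : ℝ} (hz : ∀ k, ω (a * x k) = z)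
    (hC : ∀ n : ℕ, secondMoment ω (∑ k ∈ Finset.range n, x k) ≤ n * C) : z = 0 := by
  -- The average of `x 0, …, x n` has second moment `O(1 / n)`, while its correlation with `a` is
  -- `z` for every `n`; Cauchy–Schwarz compares the two.
  have hbound : ∀ n : ℕ, (n + 1 : ℕ) * ‖z‖ ^ 2 ≤ secondMoment ω (star a) * C := fun n => by
    have hsum : ω (a * ∑ k ∈ Finset.range (n + 1), x k) = (n + 1 : ℕ) * z := by
      simp only [Finset.mul_sum, map_sum, hz, Finset.sum_const, Finset.card_range, nsmul_eq_mul]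
    refine le_of_mul_le_mul_left ?_ (Nat.cast_pos.2 n.succ_pos : (0 : ℝ) < (n + 1 : ℕ))
    calc (n + 1 : ℕ) * ((n + 1 : ℕ) * ‖z‖ ^ 2)
        = ‖ω (a * ∑ k ∈ Finset.range (n + 1), x k)‖ ^ 2 := by
          rw [hsum, norm_mul, Complex.norm_natCast]
          ring
      _ ≤ secondMoment ω (star a) * secondMoment ω (∑ k ∈ Finset.range (n + 1), x k) :=
          norm_apply_mul_sq_le hω _ _
      _ ≤ secondMoment ω (star a) * ((n + 1 : ℕ) * C) :=
          mul_le_mul_of_nonneg_left (hC _) (secondMoment_nonneg hω _)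
      _ = (n + 1 : ℕ) * (secondMoment ω (star a) * C) := by ring
  by_contra hz0
  obtain ⟨n, hn⟩ := exists_lt_nsmul (by positivity : 0 < ‖z‖ ^ 2) (secondMoment ω (star a) * C)
  have hle : n • ‖z‖ ^ 2 ≤ (n + 1) • ‖z‖ ^ 2 := nsmul_le_nsmul_left (sq_nonneg _) n.le_succ
  exact (hn.trans_le hle).not_ge (by simpa only [nsmul_eq_mul] using hbound n)

end PositiveFunctional

section ProductAndClustering

variable {A : Type*} [CStarAlgebra A] {Q : QuasiLocalAlgebra A} {α : LocalAction Q}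
  {ω : A →L[ℂ] ℂ}

/-- Condition 3 of the theorem: `ω` is multiplicative on pairs of elements with disjoint
localization, that is, observables of disjoint regions are uncorrelated. -/
def IsProduct (Q : QuasiLocalAlgebra A) (ω : A →L[ℂ] ℂ) : Prop :=
  ∀ I J : Finset ℕ+, Disjoint I J → ∀ a ∈ Q.loc I, ∀ b ∈ Q.loc J, ω (a * b) = ω a * ω b

theorem secondMoment_toHom (hinv : ∀ σ a, ω (α.toHom σ a) = ω a) (σ : FinPerm) (x : A) :
    secondMoment ω (α.toHom σ x) = secondMoment ω x := by
  rw [secondMoment, ← map_star, ← map_mul (α.toHom σ), hinv, secondMoment]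

theorem apply_mul_eq_zero_of_odd (hω : ∀ a, 0 ≤ ω (star a * a))
    (hinv : ∀ σ a, ω (α.toHom σ a) = ω a) {I J : Finset ℕ+} (hIJ : Disjoint I J) {a b : A}
    (ha : a ∈ Q.loc I) (hb : b ∈ Q.loc J) (hodd : Q.grading b = -b) :
    ω (a * b) = 0 := by
  obtain ⟨τ, hτI, hτJ⟩ := exists_seq_finPerm_disjoint_smul hIJ
  have hodd_copy : ∀ k, Q.grading (α.toHom (τ k) b) = -α.toHom (τ k) b := fun k => by
    rw [← α.map_grading, hodd, map_neg]
  have hanti : Pairwise fun j k => star (α.toHom (τ j) b) * α.toHom (τ k) b =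
      -(α.toHom (τ k) b * star (α.toHom (τ j) b)) := fun j k hjk =>
    Q.anticommute_of_odd _ _ (hτJ hjk) _ (star_mem (α.apply_mem (τ j) hb)) _
      (α.apply_mem (τ k) hb) (by rw [map_star, hodd_copy, star_neg]) (hodd_copy k)
  have hcorr : ∀ k, ω (a * α.toHom (τ k) b) = ω (a * b) := fun k => by
    rw [← hinv (τ k) (a * b), map_mul (α.toHom (τ k)), α.apply_eq_self I _ (hτI k) a ha]
  refine eq_zero_of_secondMoment_sum_le (C := secondMoment ω b + secondMoment ω (star b))
    hω hcorr fun n => (secondMoment_sum_le_of_anticommute hω _ hanti).trans_eq ?_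
  simp only [← map_star, secondMoment_toHom hinv, Finset.sum_const, Finset.card_range,
    nsmul_eq_mul]

theorem StronglyClustering.isProduct (hinv : ∀ σ a, ω (α.toHom σ a) = ω a)
    (h : StronglyClustering α ω) : IsProduct Q ω := by
  intro I J hIJ a ha b hb
  refine tendsto_nhds_unique (tendsto_const_nhds.congr' ?_) (h a b)
  filter_upwards [eventually_disjoint_sigma_smul I J] with n hn
  have hmove := map_apply_mul_apply_of_disjoint (σ := sigma n) (τ := 1) hinv ha hb hIJ
    (by rwa [one_smul])
  rwa [α.one_apply, eq_comm] at hmove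

theorem LocalAction.equicontinuous_comp (α : LocalAction Q) (φ : A →L[ℂ] ℂ) {ι : Type*}
    (σ : ι → FinPerm) : Equicontinuous fun i a => φ (α.toHom (σ i) a) :=
  (LipschitzWith.uniformEquicontinuous _ _ fun i =>
    φ.lipschitz.comp (StarAlgEquiv.isometry (α.toHom (σ i))).lipschitz).equicontinuous

theorem IsProduct.stronglyClustering (hinv : ∀ σ a, ω (α.toHom σ a) = ω a)
    (h : IsProduct Q ω) : StronglyClustering α ω := by
  have hlocal : ∀ I, ∀ a ∈ Q.loc I, ∀ J, ∀ b ∈ Q.loc J,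
      Tendsto (fun n => ω (α.toHom (sigma n) a * b)) atTop (𝓝 (ω a * ω b)) := by
    intro I a ha J b hb
    refine tendsto_const_nhds.congr' ?_
    filter_upwards [eventually_disjoint_sigma_smul I J] with n hn
    rw [h _ _ hn _ (α.apply_mem _ ha) b hb, hinv]
  have hswap : ∀ n a b, ω (α.toHom (sigma n) a * b) = ω (a * α.toHom (sigma n)⁻¹ b) :=
    fun n a b => by
      rw [← hinv (sigma n)⁻¹, map_mul (α.toHom _), ← α.mul_apply, inv_mul_cancel, α.one_apply]
  intro a b
  refine Q.induction_local (p := fun a => Tendsto _ _ (𝓝 (ω a * ω b)))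
    ((α.equicontinuous_comp (ω ∘L (ContinuousLinearMap.mul ℂ A).flip b)
      sigma).isClosed_setOfPred_tendsto (by fun_prop)) (fun I a ha => ?_) a
  refine Q.induction_local (p := fun b => Tendsto _ _ (𝓝 (ω a * ω b))) ?_ (hlocal I a ha) b
  simp only [hswap]
  exact (α.equicontinuous_comp (ω ∘L ContinuousLinearMap.mul ℂ A a)
    fun n => (sigma n)⁻¹).isClosed_setOfPred_tendsto (by fun_prop)

theorem exists_mul_secondMoment_le_of_mem_openSegment {ω₁ ω₂ : A →L[ℂ] ℂ}
    (h₂ : ∀ a, 0 ≤ ω₂ (star a * a)) (hω : ω ∈ openSegment ℝ ω₁ ω₂) :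
    ∃ s > 0, ∀ x, s * secondMoment ω₁ x ≤ secondMoment ω x := by
  obtain ⟨s, t, hs, ht, -, rfl⟩ := hω
  refine ⟨s, hs, fun x => ?_⟩
  calc s * secondMoment ω₁ x ≤ s * secondMoment ω₁ x + t * secondMoment ω₂ x :=
        le_add_of_nonneg_right (mul_nonneg ht.le (secondMoment_nonneg h₂ x))
    _ = secondMoment (s • ω₁ + t • ω₂) x := by simp [secondMoment]

theorem IsProduct.eq_zero_of_mul_secondMoment_le (h : IsProduct Q ω)
    (hinv : ∀ σ a, ω (α.toHom σ a) = ω a) {ψ : A →L[ℂ] ℂ} (hψ : ∀ a, 0 ≤ ψ (star a * a))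
    (hψinv : ∀ σ a, ψ (α.toHom σ a) = ψ a) {s : ℝ} (hs : 0 < s)
    (hdom : ∀ x, s * secondMoment ψ x ≤ secondMoment ω x) {J : Finset ℕ+} {x : A}
    (hx : x ∈ Q.loc J) (hx0 : ω x = 0) : ψ x = 0 := by
  obtain ⟨τ, -, hτ⟩ := exists_seq_finPerm_disjoint_smul (Finset.disjoint_empty_left J)
  have huncorr : Pairwise fun j k => ω (star (α.toHom (τ j) x) * α.toHom (τ k) x) = 0 :=
    fun j k hjk =>
      (h _ _ (hτ hjk) _ (star_mem (α.apply_mem (τ j) hx)) _ (α.apply_mem (τ k) hx)).trans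
        (by rw [hinv, hx0, mul_zero])
  refine eq_zero_of_secondMoment_sum_le (a := 1) (x := fun k => α.toHom (τ k) x)
    (C := secondMoment ω x / s) hψ (fun k => by rw [one_mul, hψinv]) fun n => ?_
  calc secondMoment ψ (∑ k ∈ Finset.range n, α.toHom (τ k) x)
      ≤ secondMoment ω (∑ k ∈ Finset.range n, α.toHom (τ k) x) / s :=
        (le_div_iff₀' hs).2 (hdom _)
    _ = n * (secondMoment ω x / s) := by
        simp only [secondMoment_sum_of_uncorrelated _ huncorr, secondMoment_toHom hinv,
          Finset.sum_const, Finset.card_range, nsmul_eq_mul, mul_div_assoc]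

theorem IsProduct.mem_extremePoints (hω : ω ∈ symmetricStates α) (h : IsProduct Q ω) :
    ω ∈ Set.extremePoints ℝ (symmetricStates α) := by
  refine ⟨hω, fun ω₁ h₁ ω₂ h₂ hseg => Q.continuousLinearMap_ext fun J a ha => ?_⟩
  obtain ⟨s, hs, hdom⟩ := exists_mul_secondMoment_le_of_mem_openSegment h₂.1.1 hseg
  have hzero := h.eq_zero_of_mul_secondMoment_le hω.2 h₁.1.1 h₁.2 hs hdom
    (sub_mem ha ((Q.loc J).smul_mem (one_mem _) (ω a)))
    (by rw [map_sub, map_smul, hω.1.2, smul_eq_mul, mul_one, sub_self])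
  rwa [map_sub, map_smul, h₁.1.2, smul_eq_mul, mul_one, sub_eq_zero] at hzero

end ProductAndClustering

section ExtremeStates

theorem eq_zero_of_add_mem_of_sub_mem {E : Type*} [AddCommGroup E] [Module ℝ E] {S : Set E}
    {x y : E} (hx : x ∈ Set.extremePoints ℝ S) (hadd : x + y ∈ S) (hsub : x - y ∈ S) : y = 0 :=
  add_eq_left.1 (hx.2 hadd hsub
    ⟨1 / 2, 1 / 2, one_half_pos, one_half_pos, add_halves 1, by module⟩)

theorem exists_forall_mapClusterPt_apply {ι 𝕜 E : Type*} [RCLike 𝕜] [NormedAddCommGroup E]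
    [NormedSpace 𝕜 E] {l : Filter ι} [l.NeBot] {φ : ι → E →L[𝕜] 𝕜} {C : ℝ}
    (hφ : ∀ i, ‖φ i‖ ≤ C) : ∃ ψ : E →L[𝕜] 𝕜, ∀ x, MapClusterPt (ψ x) l fun i => φ i x := by
  have hmem : ∀ i, StrongDual.toWeakDual (φ i) ∈
      WeakDual.toStrongDual ⁻¹' Metric.closedBall (0 : StrongDual 𝕜 E) C := fun i =>
    mem_closedBall_zero_iff.2 (hφ i)
  obtain ⟨ψ, -, hψ⟩ := (WeakDual.isCompact_closedBall (𝕜 := 𝕜) (0 : StrongDual 𝕜 E)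
    C).exists_mapClusterPt (f := l) (u := fun i => StrongDual.toWeakDual (φ i))
    (tendsto_principal.2 (.of_forall hmem))
  exact ⟨WeakDual.toStrongDual ψ, fun x =>
    hψ.continuousAt_comp (WeakDual.eval_continuous x).continuousAt⟩

variable {A : Type*} [CStarAlgebra A] {Q : QuasiLocalAlgebra A} {α : LocalAction Q}
  {ω φ : A →L[ℂ] ℂ}

theorem add_smul_mem_symmetricStates (hω : ω ∈ symmetricStates α) {C : ℝ} (hC : 0 < C)
    (hinv : ∀ σ a, φ (α.toHom σ a) = φ a) (hone : φ 1 = 0)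
    (hnonneg : ∀ a, 0 ≤ (C • ω + φ) (star a * a)) : ω + C⁻¹ • φ ∈ symmetricStates α := by
  have hscale : ω + C⁻¹ • φ = C⁻¹ • (C • ω + φ) := by
    rw [smul_add, inv_smul_smul₀ hC.ne']
  refine ⟨⟨fun a => ?_, ?_⟩, fun σ a => ?_⟩
  · rw [hscale, smul_apply]
    exact smul_nonneg (inv_nonneg.2 hC.le) (hnonneg a)
  · rw [add_apply, smul_apply, hone, hω.1.2, smul_zero, add_zero]
  · simp only [add_apply, smul_apply, hω.2, hinv]

theorem eq_zero_of_dominated (hω : ω ∈ Set.extremePoints ℝ (symmetricStates α)) {C : ℝ}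
    (hC : 0 < C) (hinv : ∀ σ a, φ (α.toHom σ a) = φ a) (hone : φ 1 = 0)
    (hadd : ∀ a, 0 ≤ (C • ω + φ) (star a * a)) (hsub : ∀ a, 0 ≤ (C • ω - φ) (star a * a)) :
    φ = 0 := by
  have hplus := add_smul_mem_symmetricStates hω.1 hC hinv hone hadd
  have hminus := add_smul_mem_symmetricStates (φ := -φ) hω.1 hC (fun σ a => by simp [hinv])
    (by simp [hone]) (by simpa only [sub_eq_add_neg] using hsub)
  rw [smul_neg, ← sub_eq_add_neg] at hminus
  exact (smul_eq_zero_iff_right (inv_ne_zero hC.ne')).1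
    (eq_zero_of_add_mem_of_sub_mem hω hplus hminus)

/-- `φ` is a pointwise cluster point of the functionals `a ↦ ω (a α_{σ_n}(b))`: it records the
correlations of `ω` with a copy of `b` moved to infinity. Cluster points are used because the limit
is only known to exist for local `a` and `b`. -/
def IsAsymptoticCorrelation (α : LocalAction Q) (ω : A →L[ℂ] ℂ) (b : A) (φ : A →L[ℂ] ℂ) : Prop :=
  ∀ a, MapClusterPt (φ a) atTop fun n => ω (a * α.toHom (sigma n) b)

theorem exists_isAsymptoticCorrelation (α : LocalAction Q) (ω : A →L[ℂ] ℂ) (b : A) :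
    ∃ φ, IsAsymptoticCorrelation α ω b φ := by
  refine exists_forall_mapClusterPt_apply (C := ‖ω‖ * ‖b‖)
    (φ := fun n => ω ∘L (ContinuousLinearMap.mul ℂ A).flip (α.toHom (sigma n) b)) fun n => ?_
  refine (ContinuousLinearMap.opNorm_comp_le _ _).trans_eq ?_
  rw [ContinuousLinearMap.opNorm_mul_flip_apply, StarAlgEquiv.norm_map]

theorem exists_disjoint_smul (I J : Finset ℕ+) : ∃ τ : FinPerm, Disjoint I (τ • J) :=
  let ⟨n, hn⟩ := (eventually_disjoint_sigma_smul J I).exists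
  ⟨sigma n, hn.symm⟩

namespace IsAsymptoticCorrelation

variable {I J : Finset ℕ+} {a b : A}

theorem neg (hφ : IsAsymptoticCorrelation α ω b φ) : IsAsymptoticCorrelation α ω (-b) (-φ) := by
  intro a
  simpa [Function.comp_def] using (hφ a).continuousAt_comp continuous_neg.continuousAt

theorem apply_eq_of_disjoint_smul (hφ : IsAsymptoticCorrelation α ω b φ)
    (hinv : ∀ σ a, ω (α.toHom σ a) = ω a) (ha : a ∈ Q.loc I) (hb : b ∈ Q.loc J) {τ : FinPerm}
    (hτ : Disjoint I (τ • J)) : φ a = ω (a * α.toHom τ b) := by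
  refine isClosed_singleton.mem_of_mapClusterPt (hφ a) ?_
  filter_upwards [eventually_disjoint_sigma_smul J I] with n hn
  have hmove := map_apply_mul_apply_of_disjoint (σ := 1) (τ := sigma n * τ⁻¹) hinv ha
    (α.apply_mem τ hb) hτ (by rwa [one_smul, mul_smul, inv_smul_smul, disjoint_comm])
  rwa [α.one_apply, ← α.mul_apply, inv_mul_cancel_right] at hmove

theorem apply_eq_of_disjoint (hφ : IsAsymptoticCorrelation α ω b φ)
    (hinv : ∀ σ a, ω (α.toHom σ a) = ω a) (ha : a ∈ Q.loc I) (hb : b ∈ Q.loc J)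
    (hIJ : Disjoint I J) : φ a = ω (a * b) := by
  rw [hφ.apply_eq_of_disjoint_smul (τ := 1) hinv ha hb (by rwa [one_smul]), α.one_apply]

theorem apply_toHom (hφ : IsAsymptoticCorrelation α ω b φ)
    (hinv : ∀ σ a, ω (α.toHom σ a) = ω a) (hb : b ∈ Q.loc J) (ρ : FinPerm) (a : A) :
    φ (α.toHom ρ a) = φ a := by
  refine Q.induction_local (p := fun a => φ (α.toHom ρ a) = φ a)
    (isClosed_eq (φ.continuous.comp (StarAlgEquiv.isometry (α.toHom ρ)).continuous)
      φ.continuous) (fun I a ha => ?_) a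
  obtain ⟨τ, hτ⟩ := exists_disjoint_smul I J
  have hρτ : Disjoint (ρ • I) ((ρ * τ) • J) := by
    rwa [mul_smul, ← Finset.disjoint_coe, Finset.coe_smul_finset, Finset.coe_smul_finset,
      Set.disjoint_smul_set, Finset.disjoint_coe]
  rw [hφ.apply_eq_of_disjoint_smul hinv (α.apply_mem ρ ha) hb hρτ, α.mul_apply,
    ← map_mul (α.toHom ρ), hinv, hφ.apply_eq_of_disjoint_smul hinv ha hb hτ]

theorem norm_smul_add_apply_nonneg (hφ : IsAsymptoticCorrelation α ω b φ)
    (hω : ∀ a, 0 ≤ ω (star a * a)) (hinv : ∀ σ a, ω (α.toHom σ a) = ω a) (hb : b ∈ Q.loc J)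
    (heven : Q.grading b = b) (hsa : IsSelfAdjoint b) (a : A) : 0 ≤ (‖b‖ • ω + φ) (star a * a) := by
  -- A distant copy `b'` of the even element `b` commutes with the local element `a`, whence
  -- `φ (a* a) = ω (a* b' a)`, and `‖b‖ + b' ≥ 0`.
  refine Q.induction_local (p := fun a => 0 ≤ (‖b‖ • ω + φ) (star a * a))
    (isClosed_le continuous_const (by fun_prop)) (fun I a ha => ?_) a
  obtain ⟨τ, hτ⟩ := exists_disjoint_smul I J
  set b' := α.toHom τ b with hb'
  have hnorm : ‖b'‖ = ‖b‖ := StarAlgEquiv.norm_map _ _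
  have hcomm : Commute a b' := Q.commute_of_grading_eq hτ ha (α.apply_mem τ hb)
    (by rw [hb', ← α.map_grading, heven])
  have hexpand : star a * (algebraMap ℝ A ‖b'‖ + b') * a =
      ‖b‖ • (star a * a) + star a * a * b' := by
    rw [hnorm, Algebra.algebraMap_eq_smul_one, mul_add, add_mul, mul_smul_comm, mul_one,
      smul_mul_assoc, mul_assoc _ b', ← hcomm.eq, mul_assoc]
  have hnonneg := apply_star_mul_add_mul_nonneg hω (hsa.map (α.toHom τ)) a
  rwa [← hb', hexpand, map_add, ω.map_smul_of_tower, ← smul_apply,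
    ← hφ.apply_eq_of_disjoint_smul hinv (mul_mem (star_mem ha) ha) hb hτ, ← add_apply] at hnonneg

end IsAsymptoticCorrelation

theorem apply_mul_eq_zero_of_isSelfAdjoint (hω : ω ∈ Set.extremePoints ℝ (symmetricStates α))
    {I J : Finset ℕ+} (hIJ : Disjoint I J) {a b : A} (ha : a ∈ Q.loc I) (hb : b ∈ Q.loc J)
    (heven : Q.grading b = b) (hsa : IsSelfAdjoint b) (hωb : ω b = 0) : ω (a * b) = 0 := by
  rcases eq_or_ne b 0 with rfl | hb0
  · rw [mul_zero, map_zero]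
  obtain ⟨φ, hφ⟩ := exists_isAsymptoticCorrelation α ω b
  have hone : φ 1 = 0 := by
    rw [hφ.apply_eq_of_disjoint hω.1.2 (one_mem _) hb (Finset.disjoint_empty_left J), one_mul,
      hωb]
  have hadd := hφ.norm_smul_add_apply_nonneg hω.1.1.1 hω.1.2 hb heven hsa
  have hsub := hφ.neg.norm_smul_add_apply_nonneg hω.1.1.1 hω.1.2 (neg_mem hb)
    (by rw [map_neg, heven]) hsa.neg
  rw [norm_neg] at hsub
  simp only [← sub_eq_add_neg] at hsub
  have hφ0 : φ = 0 :=
    eq_zero_of_dominated hω (norm_pos_iff.2 hb0) (hφ.apply_toHom hω.1.2 hb) hone hadd hsub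
  rw [← hφ.apply_eq_of_disjoint hω.1.2 ha hb hIJ, hφ0, zero_apply]

theorem apply_mul_eq_zero_of_even (hω : ω ∈ Set.extremePoints ℝ (symmetricStates α))
    {I J : Finset ℕ+} (hIJ : Disjoint I J) {a b : A} (ha : a ∈ Q.loc I) (hb : b ∈ Q.loc J)
    (heven : Q.grading b = b) (hωb : ω b = 0) : ω (a * b) = 0 := by
  have hself : ∀ c ∈ Q.loc J, Q.grading c = c → ω c = 0 → ω (a * c) + ω (a * star c) = 0 := by
    intro c hc hceven hωc
    rw [← map_add, ← mul_add]
    exact apply_mul_eq_zero_of_isSelfAdjoint hω hIJ ha (add_mem hc (star_mem hc))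
      (by rw [map_add, map_star, hceven]) (IsSelfAdjoint.add_star_self c)
      (by rw [map_add, map_star_of_nonneg hω.1.1.1, hωc, star_zero, add_zero])
  have hb_self := hself b hb heven hωb
  have hIb_self := hself (Complex.I • b) ((Q.loc J).smul_mem hb _) (by rw [map_smul, heven])
    (by rw [map_smul, hωb, smul_zero])
  simp only [star_smul, Complex.star_def, Complex.conj_I, mul_smul_comm, map_smul,
    smul_eq_mul] at hIb_self
  linear_combination (1 / 2) * hb_self - (Complex.I / 2) * hIb_self +
    ((ω (a * b) - ω (a * star b)) / 2) * Complex.I_sq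

theorem isProduct_of_mem_extremePoints (hω : ω ∈ Set.extremePoints ℝ (symmetricStates α)) :
    IsProduct Q ω := by
  intro I J hIJ a ha b hb
  obtain ⟨x, hx, y, hy, hxeven, hyodd, rfl⟩ := Q.exists_even_add_odd hb
  have hωy : ω y = 0 := by
    rw [← one_mul y]
    exact apply_mul_eq_zero_of_odd hω.1.1.1 hω.1.2 (Finset.disjoint_empty_left J)
      (one_mem _) hy hyodd
  have hωay : ω (a * y) = 0 := apply_mul_eq_zero_of_odd hω.1.1.1 hω.1.2 hIJ ha hy hyodd
  have hωax : ω (a * (x - ω x • 1)) = 0 := apply_mul_eq_zero_of_even hω hIJ ha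
    (sub_mem hx ((Q.loc J).smul_mem (one_mem _) (ω x)))
    (by rw [map_sub, map_smul, map_one, hxeven])
    (by rw [map_sub, map_smul, hω.1.1.2, smul_eq_mul, mul_one, sub_self])
  rw [mul_sub, mul_smul_comm, mul_one, map_sub, map_smul, smul_eq_mul, sub_eq_zero] at hωax
  rw [mul_add, map_add, map_add, hωay, hωy, hωax, add_zero, add_zero, mul_comm]

end ExtremeStates

end QuasiLocal

theorem mainTheorem3 {A : Type*} [CStarAlgebra A] (Q : QuasiLocal.QuasiLocalAlgebra A)
    (α : QuasiLocal.LocalAction Q) (ω : A →L[ℂ] ℂ) (hω : ω ∈ QuasiLocal.symmetricStates α) :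
    List.TFAE [
      ω ∈ Set.extremePoints ℝ (QuasiLocal.symmetricStates α),
      QuasiLocal.StronglyClustering α ω,
      ∀ I J : Finset ℕ+, Disjoint I J → ∀ a ∈ Q.loc I, ∀ b ∈ Q.loc J, ω (a * b) = ω a * ω b] := by
  tfae_have 1 → 3 := QuasiLocal.isProduct_of_mem_extremePoints
  tfae_have 3 → 1 := QuasiLocal.IsProduct.mem_extremePoints hω
  tfae_have 3 → 2 := QuasiLocal.IsProduct.stronglyClustering hω.2
  tfae_have 2 → 3 := QuasiLocal.StronglyClustering.isProduct hω.2
  tfae_finish
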